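/- Let $S^2$ be the unit two-sphere with its standard round metric $h_{AB}$, volume form $\epsilon_{AB}$ and Levi-Civita covariant derivative $D$, denoted by $||A$; indices are raised and lowered with $h$, $D^2=D_AD^A$, and integrals over $S^2$ are taken with respect to the volume of $h$. Let $N_A$ be a smooth one-form on $S^2$ (the angular momentum aspect at a fixed retarded time), let $\chi_{AB}$ be a smooth symmetric traceless tensor field on $S^2$ (the shear tensor at that time), and let $n:S^2\to\mathbb R$ be a linear combination of $l=1$ spherical harmonics. The Chruściel–Jezierski–Kijowski angular momentum is $$J^{(\mathrm{CJK})}=-\frac1{8\pi}\int_{S^2}\Bigl(3N_A+\tfrac14\chi_{AB}\chi^{BC}{}_{||C}\Bigr)\epsilon^{AD}n_{||D},$$ and, for $\alpha\in\mathbb R$, the Compère–Nichols angular momentum is $$J^{(\mathrm{CN})}=J^{(\mathrm{CJK})}-\frac{\alpha-1}{32\pi}\int_{S^2}\epsilon^{AD}n_{||D}\,\chi_{AB}\chi^{BC}{}_{||C}.$$ Let $b,c:S^2\to\mathbb R$ be smooth functions (the magnetic and the electric potential) such that $$\chi_{AB}=2c_{||AB}-h_{AB}D^2c+\epsilon_{AC}b^{||C}{}_{||B}+\epsilon_{BC}b^{||C}{}_{||A}.$$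 If $b=0$, then $J^{(\mathrm{CJK})}=J^{(\mathrm{CN})}$ for every $\alpha\in\mathbb R$. -/

import Mathlib

noncomputable section

open scoped Manifold ContDiff

namespace NullInfinity

/-- Euclidean three-space. -/
abbrev E3 : Type := EuclideanSpace ℝ (Fin 3)

/-- The unit two-sphere `S²`; the metric induced from `E3` is the standard round metric. -/
abbrev S2 : Type := Metric.sphere (0 : E3) 1

/-- Smooth real functions on the manifold `S²`. -/
def IsSmooth (f : S2 → ℝ) : Prop := ContMDiff (𝓡 2) 𝓘(ℝ, ℝ) ∞ f

/-!
Tensor fields on `S²` are written in the Cartesian components of the ambient space: a covariant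
tensor on the plane `T_x S² = x^⊥` is identified with the tensor on `E3` that agrees with it on
`x^⊥` and vanishes as soon as one argument is the normal `x`. On such tangential tensors,
contraction with the inverse round metric is the sum over a repeated Cartesian index, so there
is no need to distinguish upper from lower indices.
-/

/-- Smooth one-forms `η_A` on `S²`. -/
structure IsOneForm (η : S2 → Fin 3 → ℝ) : Prop where
  smooth : ∀ i, IsSmooth fun x => η x i
  tangential : ∀ x : S2, ∑ i, x.1 i * η x i = 0

/-- Smooth symmetric traceless tensor fields `T_{AB}` of rank two on `S²`. -/
structure IsSymmTracelessTensor (T : S2 → Fin 3 → Fin 3 → ℝ) : Prop where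
  smooth : ∀ i j, IsSmooth fun x => T x i j
  tangential : ∀ (x : S2) (j : Fin 3), ∑ i, x.1 i * T x i j = 0
  symm : ∀ (x : S2) (i j : Fin 3), T x i j = T x j i
  traceless : ∀ x : S2, ∑ i, T x i i = 0

/-- The extension of a function on `S²` to `E3 \ {0}` that is constant along rays from the
origin (with value `0` at the origin). -/
def radialExt (f : S2 → ℝ) (y : E3) : ℝ :=
  if hy : y = 0 then 0
  else f ⟨‖y‖⁻¹ • y, by
    simp only [mem_sphere_zero_iff_norm, norm_smul, norm_inv, norm_norm]
    exact inv_mul_cancel₀ (norm_ne_zero_iff.mpr hy)⟩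

/-- The differential of `f : S² → ℝ` at `x`, applied to the tangential part of the `k`-th
Cartesian basis vector. As `k` varies these are the components `f_{||k}` of the one-form `df`. -/
def grad (f : S2 → ℝ) (x : S2) (k : Fin 3) : ℝ :=
  fderiv ℝ (radialExt f) (x : E3) (EuclideanSpace.single k 1)

/-- The round metric `h_{ij} = δ_{ij} - x_i x_j`; as a matrix it is the orthogonal projection of
`E3` onto `T_x S²`. -/
def roundMetric (x : S2) (i j : Fin 3) : ℝ := (if i = j then 1 else 0) - x.1 i * x.1 j

/-- The volume form of the round metric, `ε_x(v, w) = det (x, v, w)`. -/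
def volForm (x : S2) (i j : Fin 3) : ℝ :=
  Matrix.det (Matrix.of ![fun k => x.1 k, Pi.single i 1, Pi.single j 1])

/-- The Levi-Civita covariant derivative `η_{i||k}` of a one-form: the tangential projection of
the ambient derivative along `S²`. -/
def covDeriv₁ (η : S2 → Fin 3 → ℝ) (x : S2) (i k : Fin 3) : ℝ :=
  ∑ p, roundMetric x i p * grad (fun y => η y p) x k

/-- The Levi-Civita covariant derivative `T_{ij||k}` of a rank two tensor field. -/
def covDeriv₂ (T : S2 → Fin 3 → Fin 3 → ℝ) (x : S2) (i j k : Fin 3) : ℝ :=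
  ∑ p, ∑ q, roundMetric x i p * roundMetric x j q * grad (fun y => T y p q) x k

/-- The covariant Hessian `f_{||ij}`. -/
def hess (f : S2 → ℝ) (x : S2) (i j : Fin 3) : ℝ := covDeriv₁ (grad f) x i j

/-- The Laplacian `D² f = f^{||A}_{||A}`. -/
def laplacian (f : S2 → ℝ) (x : S2) : ℝ := ∑ i, hess f x i i

/-- The divergence `T^{BC}_{||C}`. -/
def divergence (T : S2 → Fin 3 → Fin 3 → ℝ) (x : S2) (j : Fin 3) : ℝ :=
  ∑ k, covDeriv₂ T x j k k

/-- The integral over `S²` with respect to the standard volume (total area `4π`). -/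
def sphereIntegral (f : S2 → ℝ) : ℝ :=
  ∫ x, f x ∂((MeasureTheory.volume : MeasureTheory.Measure E3).toSphere)

/-- Linear combinations of the `l = 1` spherical harmonics, that is, restrictions to `S²` of
linear functions on `E3`. -/
def IsDipole (n : S2 → ℝ) : Prop := ∃ a : Fin 3 → ℝ, ∀ x : S2, n x = ∑ i, a i * x.1 i

/-- The tensor field with electric potential `c` and magnetic potential `b`,
`2 c_{||AB} - h_{AB} D² c + ε_{AC} b^{||C}_{||B} + ε_{BC} b^{||C}_{||A}`. -/
def tensorOfPotentials (c b : S2 → ℝ) (x : S2) (i j : Fin 3) : ℝ :=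
  2 * hess c x i j - roundMetric x i j * laplacian c x
    + ∑ k, volForm x i k * hess b x k j + ∑ k, volForm x j k * hess b x k i

/-- The Chruściel–Jezierski–Kijowski angular momentum
`-1/(8π) ∫ (3 N_A + 1/4 χ_{AB} χ^{BC}_{||C}) ε^{AD} n_{||D}`. -/
def angMomCJK (N : S2 → Fin 3 → ℝ) (χ : S2 → Fin 3 → Fin 3 → ℝ) (n : S2 → ℝ) : ℝ :=
  -(1 / (8 * Real.pi)) * sphereIntegral fun x =>
    ∑ i, ∑ l, (3 * N x i + 1 / 4 * ∑ j, χ x i j * divergence χ x j) * volForm x i l * grad n x l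

/-- The Compère–Nichols angular momentum with parameter `α`,
`J^{CJK} - (α - 1)/(32π) ∫ ε^{AD} n_{||D} χ_{AB} χ^{BC}_{||C}`. -/
def angMomCN (α : ℝ) (N : S2 → Fin 3 → ℝ) (χ : S2 → Fin 3 → Fin 3 → ℝ) (n : S2 → ℝ) : ℝ :=
  angMomCJK N χ n - (α - 1) / (32 * Real.pi) * sphereIntegral fun x =>
    ∑ i, ∑ l, ∑ j, volForm x i l * grad n x l * χ x i j * divergence χ x j

end NullInfinity

end

noncomputable section

open scoped Manifold ContDiff Topology
open MeasureTheory

namespace NullInfinity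

/-! The two angular momenta differ by a multiple of `∫ Y^A χ_{AB} χ^{BC}_{||C}`, where `Y^A = ε^{AD}
n_{||D}` is a rotation (Killing) field. For `b = 0` the divergence of `χ` is the gradient of `F = D²
c + 2 c` (`sum_grad_electric`). Put `W_B = Y^A χ_{AB}`. As `D_B Y_A` is antisymmetric and `χ`
symmetric, `div W = Y · grad F`; as moreover `div Y = 0`, the field `F W - F² Y / 2` has divergence
`W · grad F`, which is the integrand. It integrates to zero by
`sphereIntegral_rotation_mul_grad_eq_zero`.

All calculus takes place in `E3`, on extensions constant along rays. The divergence theorem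
`sphereIntegral_div_eq_zero` then follows from integration by parts in `E3` against a radial cutoff,
followed by polar coordinates. -/

/-! ### Radial extensions and their smoothness. -/

/-- A function on `S²` is radially smooth if its radial extension is smooth away from the
origin. -/
def IsRadiallySmooth (f : S2 → ℝ) : Prop := ContDiffOn ℝ ∞ (radialExt f) {0}ᶜ

theorem S2.ne_zero (x : S2) : (x : E3) ≠ 0 := ne_zero_of_mem_unit_sphere x

theorem S2.norm_eq (x : S2) : ‖(x : E3)‖ = 1 := norm_eq_of_mem_sphere x

theorem S2.sum_sq (x : S2) : ∑ i, x.1 i * x.1 i = 1 := by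
  have h := EuclideanSpace.real_norm_sq_eq (x : E3)
  rw [S2.norm_eq] at h
  simpa [sq] using h.symm

/-- The radial projection of a nonzero vector to the sphere. -/
def radialProj (y : E3) (hy : y ≠ 0) : S2 :=
  ⟨‖y‖⁻¹ • y, by simp [norm_smul, hy]⟩

theorem radialExt_of_ne (f : S2 → ℝ) {y : E3} (hy : y ≠ 0) :
    radialExt f y = f (radialProj y hy) := by
  simp [radialExt, hy, radialProj]

theorem radialExt_smul (f : S2 → ℝ) (y : E3) {r : ℝ} (hr : 0 < r) :
    radialExt f (r • y) = radialExt f y := by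
  by_cases hy : y = 0
  · simp [hy]
  have hry : r • y ≠ 0 := smul_ne_zero hr.ne' hy
  rw [radialExt_of_ne f hy, radialExt_of_ne f hry]
  congr 1
  ext1
  simp [radialProj, norm_smul, abs_of_pos hr, smul_smul]
  field_simp

@[simp]
theorem radialExt_coe (f : S2 → ℝ) (x : S2) : radialExt f (x : E3) = f x := by
  rw [radialExt_of_ne f x.ne_zero]
  congr 1
  ext1
  simp [radialProj]

theorem IsRadiallySmooth.contDiffAt {f : S2 → ℝ} (hf : IsRadiallySmooth f) {y : E3}
    (hy : y ≠ 0) : ContDiffAt ℝ ∞ (radialExt f) y :=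
  ContDiffOn.contDiffAt hf (isOpen_compl_singleton.mem_nhds hy)

theorem IsRadiallySmooth.differentiableAt {f : S2 → ℝ} (hf : IsRadiallySmooth f) {y : E3}
    (hy : y ≠ 0) : DifferentiableAt ℝ (radialExt f) y :=
  (hf.contDiffAt hy).differentiableAt (by simp)

/-- A smooth function on the manifold `S²` is radially smooth. -/
theorem IsSmooth.isRadiallySmooth {f : S2 → ℝ} (hf : IsSmooth f) : IsRadiallySmooth f := by
  intro y hy
  -- On the open submanifold `E3 \ {0}` the extension is `f` composed with the smooth map `y ↦ y /
  -- ‖y‖` into the sphere.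
  let U : TopologicalSpace.Opens E3 := ⟨{0}ᶜ, isOpen_compl_singleton⟩
  have hU : ∀ z : U, (z : E3) ≠ 0 := fun z => z.2
  have h₁ : ContMDiff 𝓘(ℝ, E3) 𝓘(ℝ, E3) ∞ (fun z : U => ‖(z : E3)‖⁻¹ • (z : E3)) := by
    intro z
    have : ContDiffAt ℝ ∞ (fun w : E3 => ‖w‖⁻¹ • w) (z : E3) :=
      ((contDiffAt_norm ℝ (hU z)).inv (norm_ne_zero_iff.2 (hU z))).smul contDiffAt_id
    exact contMDiffAt_subtype_iff.2 this.contMDiffAt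
  have : Fact (Module.finrank ℝ E3 = 2 + 1) := ⟨finrank_euclideanSpace_fin⟩
  have h₂ := h₁.codRestrict_sphere (n := 2) (fun z => by simp [norm_smul, hU z])
  have h₃ := hf.comp h₂
  have h₄ : ContMDiffAt 𝓘(ℝ, E3) 𝓘(ℝ, ℝ) ∞ (radialExt f) ((⟨y, hy⟩ : U) : E3) := by
    rw [← contMDiffAt_subtype_iff]
    convert h₃ ⟨y, hy⟩ using 1
    ext z
    exact radialExt_of_ne f (hU z)
  exact h₄.contDiffAt.contDiffWithinAt

theorem IsRadiallySmooth.congr {f : S2 → ℝ} {G : E3 → ℝ} (hG : ContDiffOn ℝ ∞ G {0}ᶜ)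
    (h : ∀ (y : E3) (_ : y ≠ 0), radialExt f y = G y) : IsRadiallySmooth f :=
  ContDiffOn.congr hG fun y hy => h y hy

theorem isRadiallySmooth_const (a : ℝ) : IsRadiallySmooth fun _ => a :=
  .congr contDiffOn_const fun _ hy => radialExt_of_ne _ hy

theorem IsRadiallySmooth.add {f g : S2 → ℝ} (hf : IsRadiallySmooth f) (hg : IsRadiallySmooth g) :
    IsRadiallySmooth fun x => f x + g x :=
  .congr (ContDiffOn.add hf hg) fun _ hy => by simp [radialExt_of_ne _ hy]

theorem IsRadiallySmooth.sub {f g : S2 → ℝ} (hf : IsRadiallySmooth f) (hg : IsRadiallySmooth g) :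
    IsRadiallySmooth fun x => f x - g x :=
  .congr (ContDiffOn.sub hf hg) fun _ hy => by simp [radialExt_of_ne _ hy]

theorem IsRadiallySmooth.mul {f g : S2 → ℝ} (hf : IsRadiallySmooth f) (hg : IsRadiallySmooth g) :
    IsRadiallySmooth fun x => f x * g x :=
  .congr (ContDiffOn.mul hf hg) fun _ hy => by simp [radialExt_of_ne _ hy]

theorem IsRadiallySmooth.const_mul {f : S2 → ℝ} (a : ℝ) (hf : IsRadiallySmooth f) :
    IsRadiallySmooth fun x => a * f x :=
  (isRadiallySmooth_const a).mul hf

theorem IsRadiallySmooth.sum {f : Fin 3 → S2 → ℝ} (hf : ∀ i, IsRadiallySmooth (f i)) :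
    IsRadiallySmooth fun x => ∑ i, f i x :=
  .congr (ContDiffOn.sum (s := Finset.univ) fun i _ => hf i)
    fun _ hy => by simp [radialExt_of_ne _ hy]

theorem radialExt_coord (i : Fin 3) {y : E3} (hy : y ≠ 0) :
    radialExt (fun x => x.1 i) y = ‖y‖⁻¹ * y i := by
  simp [radialExt_of_ne _ hy, radialProj]

theorem contDiff_coord (i : Fin 3) : ContDiff ℝ ∞ fun y : E3 => y i :=
  (EuclideanSpace.proj (𝕜 := ℝ) (ι := Fin 3) i).contDiff

theorem isRadiallySmooth_coord (i : Fin 3) : IsRadiallySmooth fun x => x.1 i := by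
  refine .congr (G := fun y => ‖y‖⁻¹ * y i) ?_ fun y hy => radialExt_coord i hy
  intro y hy
  exact (((contDiffAt_norm ℝ hy).inv (norm_ne_zero_iff.2 hy)).mul
    (contDiff_coord i).contDiffAt).contDiffWithinAt

/-! ### Calculus of the tangential derivative. -/

theorem IsRadiallySmooth.hasFDerivAt {f : S2 → ℝ} (hf : IsRadiallySmooth f) {y : E3}
    (hy : y ≠ 0) : HasFDerivAt (radialExt f) (fderiv ℝ (radialExt f) y) y :=
  (hf.differentiableAt hy).hasFDerivAt

theorem grad_eq_of_hasFDerivAt {f : S2 → ℝ} {G : E3 → ℝ} {x : S2} {G' : E3 →L[ℝ] ℝ}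
    (hG : HasFDerivAt G G' x) (h : ∀ (y : E3) (_ : y ≠ 0), radialExt f y = G y) (k : Fin 3) :
    grad f x k = G' (EuclideanSpace.single k 1) := by
  have : radialExt f =ᶠ[𝓝 (x : E3)] G :=
    Filter.eventually_of_mem (isOpen_compl_singleton.mem_nhds x.ne_zero) fun y hy => h y hy
  rw [grad, this.fderiv_eq, hG.fderiv]

theorem grad_add {f g : S2 → ℝ} (hf : IsRadiallySmooth f) (hg : IsRadiallySmooth g) (x : S2)
    (k : Fin 3) : grad (fun y => f y + g y) x k = grad f x k + grad g x k :=
  grad_eq_of_hasFDerivAt ((hf.hasFDerivAt x.ne_zero).add (hg.hasFDerivAt x.ne_zero))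
    (fun _ hy => by simp [radialExt_of_ne _ hy]) k

theorem grad_sub {f g : S2 → ℝ} (hf : IsRadiallySmooth f) (hg : IsRadiallySmooth g) (x : S2)
    (k : Fin 3) : grad (fun y => f y - g y) x k = grad f x k - grad g x k :=
  grad_eq_of_hasFDerivAt ((hf.hasFDerivAt x.ne_zero).sub (hg.hasFDerivAt x.ne_zero))
    (fun _ hy => by simp [radialExt_of_ne _ hy]) k

theorem grad_mul {f g : S2 → ℝ} (hf : IsRadiallySmooth f) (hg : IsRadiallySmooth g) (x : S2)
    (k : Fin 3) : grad (fun y => f y * g y) x k = grad f x k * g x + f x * grad g x k := by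
  rw [grad_eq_of_hasFDerivAt ((hf.hasFDerivAt x.ne_zero).mul (hg.hasFDerivAt x.ne_zero))
    (fun _ hy => by simp [radialExt_of_ne _ hy]) k]
  simp [grad]
  ring

theorem grad_const (a : ℝ) (x : S2) (k : Fin 3) : grad (fun _ => a) x k = 0 := by
  rw [grad_eq_of_hasFDerivAt (hasFDerivAt_const a (x : E3)) (fun _ hy => radialExt_of_ne _ hy)]
  simp

theorem grad_const_mul {f : S2 → ℝ} (a : ℝ) (hf : IsRadiallySmooth f) (x : S2) (k : Fin 3) :
    grad (fun y => a * f y) x k = a * grad f x k := by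
  rw [grad_mul (isRadiallySmooth_const a) hf, grad_const]
  ring

theorem grad_sum {f : Fin 3 → S2 → ℝ} (hf : ∀ i, IsRadiallySmooth (f i)) (x : S2) (k : Fin 3) :
    grad (fun y => ∑ i, f i y) x k = ∑ i, grad (f i) x k := by
  rw [grad_eq_of_hasFDerivAt
    (HasFDerivAt.fun_sum (u := Finset.univ) fun i _ => (hf i).hasFDerivAt x.ne_zero)
    (fun _ hy => by simp [radialExt_of_ne _ hy]) k]
  simp [grad]

theorem hasFDerivAt_norm_coe (x : S2) :
    HasFDerivAt (fun y : E3 => ‖y‖) (fderiv ℝ (fun y : E3 => ‖y‖) (x : E3)) (x : E3) :=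
  ((contDiffAt_norm (n := 1) ℝ x.ne_zero).differentiableAt (by simp)).hasFDerivAt

theorem fderiv_norm_coe (x : S2) (k : Fin 3) :
    fderiv ℝ (fun y : E3 => ‖y‖) x (EuclideanSpace.single k 1) = x.1 k := by
  -- Differentiating `‖y‖² = ‖y‖ · ‖y‖` at a unit vector avoids a direct formula for the derivative
  -- of the norm.
  have h₁ := (hasFDerivAt_norm_coe x).mul (hasFDerivAt_norm_coe x)
  have h₂ : fderiv ℝ (fun y : E3 => ‖y‖ ^ 2) x (EuclideanSpace.single k 1) = 2 * x.1 k := by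
    rw [fderiv_norm_sq_apply]
    simp [EuclideanSpace.inner_single_right]
  have h₃ : (fun y : E3 => ‖y‖ ^ 2) = (fun y : E3 => ‖y‖) * fun y : E3 => ‖y‖ := by
    ext y
    simp [sq]
  rw [h₃, h₁.fderiv] at h₂
  simp at h₂
  linarith

/-- The derivative of the radial extension scales like the inverse of the radius. -/
theorem radialExt_grad (f : S2 → ℝ) (k : Fin 3) {y : E3} (hy : y ≠ 0) :
    radialExt (fun x => grad f x k) y =
      ‖y‖ * fderiv ℝ (radialExt f) y (EuclideanSpace.single k 1) := by
  have hr : 0 < ‖y‖⁻¹ := inv_pos.2 (norm_pos_iff.2 hy)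
  have h₁ : (fun z => radialExt f (‖y‖⁻¹ • z)) = radialExt f :=
    funext fun z => radialExt_smul f z hr
  have h₂ := fderiv_comp_smul (𝕜 := ℝ) (f := radialExt f) (x := y) ‖y‖⁻¹
  rw [h₁] at h₂
  rw [radialExt_of_ne _ hy, grad, h₂]
  have : ‖y‖ ≠ 0 := norm_ne_zero_iff.2 hy
  simp [radialProj, this]

theorem contDiffAt_fderiv_apply {f : S2 → ℝ} (hf : IsRadiallySmooth f) (v : E3) {y : E3}
    (hy : y ≠ 0) : ContDiffAt ℝ ∞ (fun z => fderiv ℝ (radialExt f) z v) y :=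
  ((hf.contDiffAt hy).fderiv_right (m := ∞) (by simp)).clm_apply contDiffAt_const

theorem IsRadiallySmooth.grad {f : S2 → ℝ} (hf : IsRadiallySmooth f) (k : Fin 3) :
    IsRadiallySmooth fun x => grad f x k := by
  refine .congr (G := fun y => ‖y‖ * fderiv ℝ (radialExt f) y (EuclideanSpace.single k 1)) ?_
    fun y hy => radialExt_grad f k hy
  intro y hy
  exact ((contDiffAt_norm ℝ hy).mul (contDiffAt_fderiv_apply hf _ hy)).contDiffWithinAt

theorem grad_coord (x : S2) (i k : Fin 3) :
    grad (fun y => y.1 i) x k = roundMetric x i k := by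
  have h₁ := (hasFDerivAt_norm_coe x).mul ((isRadiallySmooth_coord i).hasFDerivAt x.ne_zero)
  have h₂ : HasFDerivAt (fun y : E3 => y i) (EuclideanSpace.proj (𝕜 := ℝ) i) (x : E3) :=
    (EuclideanSpace.proj (𝕜 := ℝ) (ι := Fin 3) i).hasFDerivAt
  have h₃ : (fun y : E3 => y i) =ᶠ[𝓝 (x : E3)]
      (fun y => ‖y‖) * radialExt fun z => z.1 i := by
    filter_upwards [isOpen_compl_singleton.mem_nhds x.ne_zero] with y hy
    have : ‖y‖ ≠ 0 := norm_ne_zero_iff.2 hy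
    simp only [Pi.mul_apply, radialExt_coord i hy]
    field_simp
  have h₄ := congrArg (fun A : E3 →L[ℝ] ℝ => A (EuclideanSpace.single k 1))
    (h₂.unique (h₃.hasFDerivAt_iff.2 h₁))
  simp [fderiv_norm_coe] at h₄
  rw [grad, roundMetric]
  linarith

/-- The extension is constant along the ray through `x`, so its radial derivative vanishes. -/
theorem sum_coord_mul_grad {f : S2 → ℝ} (hf : IsRadiallySmooth f) (x : S2) :
    ∑ k, x.1 k * grad f x k = 0 := by
  have h₁ : fderiv ℝ (radialExt f) (x : E3) (x : E3) = ∑ k, x.1 k * grad f x k := by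
    have h := congrArg (fderiv ℝ (radialExt f) (x : E3))
      ((EuclideanSpace.basisFun (Fin 3) ℝ).sum_repr (x : E3))
    simpa [grad] using h.symm
  rw [← h₁]
  have h₂ : HasDerivAt (fun t : ℝ => radialExt f (t • (x : E3)))
      (fderiv ℝ (radialExt f) (x : E3) (x : E3)) 1 := by
    have h₃ : HasDerivAt (fun t : ℝ => t • (x : E3)) (x : E3) 1 := by
      simpa using (hasDerivAt_id (1 : ℝ)).smul_const (x : E3)
    exact HasFDerivAt.comp_hasDerivAt (1 : ℝ)
      (by simpa using hf.hasFDerivAt x.ne_zero) h₃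
  have h₄ : (fun t : ℝ => radialExt f (t • (x : E3))) =ᶠ[𝓝 1] fun _ => f x := by
    filter_upwards [lt_mem_nhds (zero_lt_one' ℝ)] with t ht
    simp [radialExt_smul f _ ht]
  exact h₂.unique (h₄.hasDerivAt_iff.2 (hasDerivAt_const _ _))

/-- Extending `grad f` radially multiplies the ambient derivative by `‖y‖`; differentiating this
factor gives the first-order term. It is the only part not symmetric in `i` and `j`. -/
theorem grad_grad {f : S2 → ℝ} (hf : IsRadiallySmooth f) (x : S2) (i j : Fin 3) :
    grad (fun y => grad f y j) x i = x.1 i * grad f x j +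
      fderiv ℝ (fderiv ℝ (radialExt f)) (x : E3) (EuclideanSpace.single i 1)
        (EuclideanSpace.single j 1) := by
  have h₁ : HasFDerivAt (fderiv ℝ (radialExt f)) _ (x : E3) :=
    (((hf.contDiffAt x.ne_zero).fderiv_right (m := ∞) (by simp)).differentiableAt
      (by simp)).hasFDerivAt
  have h₂ := h₁.clm_apply (hasFDerivAt_const (EuclideanSpace.single j (1 : ℝ)) (x : E3))
  rw [grad_eq_of_hasFDerivAt ((hasFDerivAt_norm_coe x).mul h₂)
    (fun y hy => radialExt_grad f j hy) i]
  simp [fderiv_norm_coe, grad]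
  ring

/-- The commutator of the tangential derivatives. -/
theorem grad_grad_comm {f : S2 → ℝ} (hf : IsRadiallySmooth f) (x : S2) (i j : Fin 3) :
    grad (fun y => grad f y j) x i =
      grad (fun y => grad f y i) x j + x.1 i * grad f x j - x.1 j * grad f x i := by
  have hs : IsSymmSndFDerivAt ℝ (radialExt f) (x : E3) :=
    (hf.contDiffAt x.ne_zero).isSymmSndFDerivAt (by simpa using (ENat.LEInfty.out : (2 : WithTop ℕ∞) ≤ ∞))
  rw [grad_grad hf, grad_grad hf, hs.eq]
  ring

/-! ### The divergence theorem on the sphere. -/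

/-- Integration in polar coordinates of a product of a radial weight and a function of the
direction. -/
theorem integral_radial_mul_radialExt (w : ℝ → ℝ) (f : S2 → ℝ) :
    ∫ y : E3, w ‖y‖ * radialExt f y =
      sphereIntegral f * ∫ r : Set.Ioi (0 : ℝ), w r ∂Measure.volumeIoiPow 2 := by
  have hdim : Module.finrank ℝ E3 - 1 = 2 := by simp
  calc
    ∫ y : E3, w ‖y‖ * radialExt f y
      = ∫ y : ({0}ᶜ : Set E3), w ‖y.1‖ * radialExt f y.1
          ∂((volume : Measure E3).comap (↑)) := by
      rw [integral_subtype_comap (measurableSet_singleton _).compl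
        fun y : E3 => w ‖y‖ * radialExt f y, restrict_compl_singleton]
    _ = ∫ p : S2 × Set.Ioi (0 : ℝ), f p.1 * w p.2
          ∂((volume : Measure E3).toSphere.prod (.volumeIoiPow 2)) := by
      have h := (volume : Measure E3).measurePreserving_homeomorphUnitSphereProd.integral_comp
        (Homeomorph.measurableEmbedding _) (fun p => f p.1 * w p.2)
      rw [hdim] at h
      rw [← h]
      congr 1
      ext y
      rw [radialExt_of_ne f y.2, mul_comm]
      congr 2
      · ext1
        simp [radialProj]
      · simp
    _ = _ := integral_prod_mul f fun r : Set.Ioi (0 : ℝ) => w r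

/-- A smooth radial cutoff function supported in an annulus around the origin. -/
def annulusBump : ContDiffBump (2 : ℝ) := ⟨1 / 2, 1, by norm_num, by norm_num⟩

/-- Composing with `‖y‖²` instead of `‖y‖` gives smoothness at the origin too. -/
theorem contDiff_annulusBump : ContDiff ℝ ∞ fun y : E3 => annulusBump (‖y‖ ^ 2) :=
  annulusBump.contDiff.comp (contDiff_norm_sq ℝ)

theorem hasCompactSupport_annulusBump :
    HasCompactSupport fun y : E3 => annulusBump (‖y‖ ^ 2) := by
  refine HasCompactSupport.intro (isCompact_closedBall (0 : E3) 2) fun y hy => ?_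
  apply annulusBump.zero_of_le_dist
  rw [mem_closedBall_zero_iff, not_le] at hy
  change 1 ≤ |‖y‖ ^ 2 - 2|
  rw [abs_of_nonneg] <;> nlinarith

theorem tsupport_annulusBump : tsupport (fun y : E3 => annulusBump (‖y‖ ^ 2)) ⊆ {0}ᶜ := by
  intro y hy h0
  rw [Set.mem_singleton_iff] at h0
  subst h0
  refine notMem_tsupport_iff_eventuallyEq.2 ?_ hy
  filter_upwards [Metric.ball_mem_nhds (0 : E3) one_pos] with z hz
  apply annulusBump.zero_of_le_dist
  rw [mem_ball_zero_iff] at hz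
  have := norm_nonneg z
  change 1 ≤ |‖z‖ ^ 2 - 2|
  rw [abs_of_nonpos] <;> nlinarith

theorem fderiv_annulusBump (y : E3) (k : Fin 3) :
    fderiv ℝ (fun z : E3 => annulusBump (‖z‖ ^ 2)) y (EuclideanSpace.single k 1) =
      2 * deriv annulusBump (‖y‖ ^ 2) * y k := by
  have h₁ : HasDerivAt annulusBump (deriv annulusBump (‖y‖ ^ 2)) (‖y‖ ^ 2) :=
    ((annulusBump.contDiff (n := 1)).differentiable (by simp) _).hasDerivAt
  have h₂ := h₁.comp_hasFDerivAt y (hasStrictFDerivAt_norm_sq y).hasFDerivAt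
  have h₃ : fderiv ℝ (fun z : E3 => annulusBump (‖z‖ ^ 2)) y = _ := h₂.fderiv
  rw [h₃]
  simp [EuclideanSpace.inner_single_right]
  ring

/-- Radial extensions are in general discontinuous at the origin; a weight supported away from it
hides this. -/
theorem continuous_mul_of_tsupport_subset {ρ g : E3 → ℝ} (hρ : Continuous ρ)
    (hs : tsupport ρ ⊆ {0}ᶜ) (hg : ContinuousOn g {0}ᶜ) : Continuous fun y => ρ y * g y :=
  (hρ.continuousOn.mul hg).continuous_of_tsupport_subset isOpen_compl_singleton
    ((closure_mono (Function.support_mul_subset_left ρ g)).trans hs)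

theorem integrable_mul_of_tsupport_subset {ρ g : E3 → ℝ} (hρ : Continuous ρ)
    (hc : HasCompactSupport ρ) (hs : tsupport ρ ⊆ {0}ᶜ) (hg : ContinuousOn g {0}ᶜ) :
    Integrable fun y => ρ y * g y :=
  (continuous_mul_of_tsupport_subset hρ hs hg).integrable_of_hasCompactSupport hc.mul_right

/-- This is the radial factor to be cancelled in the divergence theorem. Polar coordinates with `f =
1` turn it into the integral of a nonzero, nonnegative continuous function. -/
theorem integral_annulusBump_weight_ne_zero :
    ∫ r : Set.Ioi (0 : ℝ), annulusBump (r.1 ^ 2) * r.1⁻¹ ∂Measure.volumeIoiPow 2 ≠ 0 := by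
  intro h0
  have h := integral_radial_mul_radialExt (fun r => annulusBump (r ^ 2) * r⁻¹) fun _ => 1
  rw [h0, mul_zero] at h
  have hne : ContinuousOn (fun y : E3 => ‖y‖⁻¹) {0}ᶜ :=
    continuous_norm.continuousOn.inv₀ fun y hy => norm_ne_zero_iff.2 hy
  have hcont := continuous_mul_of_tsupport_subset contDiff_annulusBump.continuous
    tsupport_annulusBump hne
  have hpos : 0 < ∫ y : E3, annulusBump (‖y‖ ^ 2) * ‖y‖⁻¹ := by
    refine hcont.integral_pos_of_hasCompactSupport_nonneg_nonzero
      hasCompactSupport_annulusBump.mul_right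
      (fun y => mul_nonneg annulusBump.nonneg (inv_nonneg.2 (norm_nonneg y)))
      -- At norm `√2` the argument of the bump is its centre `2`.
      (x := EuclideanSpace.single 0 √2) ?_
    have h₁ : ‖(EuclideanSpace.single 0 √2 : E3)‖ = √2 := by simp
    have h₂ : annulusBump (2 : ℝ) = 1 :=
      annulusBump.one_of_mem_closedBall (by simp [annulusBump])
    simp [h₁, h₂]
  refine hpos.ne' ?_
  rw [← h]
  congr 1
  ext y
  by_cases hy : y = 0
  · simp [hy]
  · simp [radialExt_of_ne _ hy]

/-- The divergence theorem on the closed surface `S²`. -/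
theorem sphereIntegral_div_eq_zero {V : Fin 3 → S2 → ℝ} (hV : ∀ k, IsRadiallySmooth (V k))
    (htan : ∀ x : S2, ∑ k, x.1 k * V k x = 0) :
    sphereIntegral (fun x => ∑ k, grad (V k) x k) = 0 := by
  let ρ : E3 → ℝ := fun y => annulusBump (‖y‖ ^ 2)
  let e : Fin 3 → E3 := fun k => EuclideanSpace.single k 1
  have hρ : ContDiff ℝ ∞ ρ := contDiff_annulusBump
  have hρc : HasCompactSupport ρ := hasCompactSupport_annulusBump
  have hρs : tsupport ρ ⊆ {0}ᶜ := tsupport_annulusBump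
  have hint₁ : ∀ k, Integrable fun y => ρ y * fderiv ℝ (radialExt (V k)) y (e k) := fun k =>
    integrable_mul_of_tsupport_subset hρ.continuous hρc hρs fun y hy =>
      (contDiffAt_fderiv_apply (hV k) _ hy).continuousAt.continuousWithinAt
  have hint₂ : ∀ k, Integrable fun y => fderiv ℝ ρ y (e k) * radialExt (V k) y := fun k =>
    integrable_mul_of_tsupport_subset
      ((hρ.continuous_fderiv (by simp)).clm_apply continuous_const)
      (hρc.fderiv_apply ℝ (e k)) ((tsupport_fderiv_apply_subset ℝ (e k)).trans hρs)
      (hV k).continuousOn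
  have hparts : ∀ k, ∫ y, ρ y * fderiv ℝ (radialExt (V k)) y (e k) =
      -∫ y, fderiv ℝ ρ y (e k) * radialExt (V k) y := fun k =>
    integral_mul_fderiv_eq_neg_fderiv_mul_of_integrable (hint₂ k) (hint₁ k)
      (integrable_mul_of_tsupport_subset hρ.continuous hρc hρs (hV k).continuousOn)
      (fun y _ => hρ.differentiable (by simp) y)
      (fun y hy => (hV k).differentiableAt (hρs hy))
  -- The gradient of the cutoff is radial and `V` is tangential.
  have hzero : ∀ y, ∑ k, fderiv ℝ ρ y (e k) * radialExt (V k) y = 0 := by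
    intro y
    by_cases hy : y = 0
    · simp [hy, radialExt]
    have h := htan (radialProj y hy)
    have hn : ‖y‖ ≠ 0 := norm_ne_zero_iff.2 hy
    simp only [ρ, e, fderiv_annulusBump, radialExt_of_ne _ hy]
    calc
      _ = 2 * deriv annulusBump (‖y‖ ^ 2) * ‖y‖ *
          ∑ k, (radialProj y hy).1 k * V k (radialProj y hy) := by
        rw [Finset.mul_sum]
        refine Finset.sum_congr rfl fun k _ => ?_
        have : (radialProj y hy).1 k = ‖y‖⁻¹ * y k := by simp [radialProj]
        rw [this]
        field_simp
      _ = 0 := by rw [h, mul_zero]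
  have hsum : ∫ y, ∑ k, ρ y * fderiv ℝ (radialExt (V k)) y (e k) = 0 := by
    rw [integral_finsetSum _ fun k _ => hint₁ k, Finset.sum_congr rfl fun k _ => hparts k,
      Finset.sum_neg_distrib, ← integral_finsetSum _ fun k _ => hint₂ k]
    simp [hzero]
  -- The factor `r⁻¹` compensates the `‖y‖` in `radialExt_grad`.
  have hpolar := integral_radial_mul_radialExt (fun r => annulusBump (r ^ 2) * r⁻¹)
    fun x => ∑ k, grad (V k) x k
  have heq : (fun y : E3 => annulusBump (‖y‖ ^ 2) * ‖y‖⁻¹ *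
      radialExt (fun x => ∑ k, grad (V k) x k) y) =
      fun y => ∑ k, ρ y * fderiv ℝ (radialExt (V k)) y (e k) := by
    ext y
    by_cases hy : y = 0
    · have : ρ 0 = 0 := image_eq_zero_of_notMem_tsupport fun h => hρs h rfl
      simp [hy, this]
    have hn : ‖y‖ ≠ 0 := norm_ne_zero_iff.2 hy
    have h : ∀ k, grad (V k) (radialProj y hy) k =
        ‖y‖ * fderiv ℝ (radialExt (V k)) y (e k) := fun k => by
      rw [← radialExt_grad (V k) k hy, radialExt_of_ne _ hy]
    rw [radialExt_of_ne _ hy, Finset.mul_sum]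
    refine Finset.sum_congr rfl fun k _ => ?_
    rw [h]
    simp only [ρ]
    field_simp
  rw [heq, hsum] at hpolar
  exact (mul_eq_zero.1 hpolar.symm).resolve_right integral_annulusBump_weight_ne_zero

/-! ### Metric, Hessian and Laplacian in Cartesian components. -/

theorem isRadiallySmooth_roundMetric (i j : Fin 3) :
    IsRadiallySmooth fun x => roundMetric x i j :=
  (isRadiallySmooth_const _).sub ((isRadiallySmooth_coord i).mul (isRadiallySmooth_coord j))

theorem sum_roundMetric_mul (x : S2) (i : Fin 3) (v : Fin 3 → ℝ) :
    ∑ p, roundMetric x i p * v p = v i - x.1 i * ∑ p, x.1 p * v p := by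
  simp [roundMetric, sub_mul, Finset.sum_sub_distrib, Finset.mul_sum, mul_assoc]

theorem roundMetric_symm (x : S2) (i j : Fin 3) : roundMetric x i j = roundMetric x j i := by
  simp [roundMetric, eq_comm, mul_comm]

theorem sum_coord_mul_roundMetric (x : S2) (i : Fin 3) :
    ∑ p, x.1 p * roundMetric x p i = 0 := by
  simp_rw [mul_comm (x.1 _), roundMetric_symm x _ i]
  rw [sum_roundMetric_mul, S2.sum_sq]
  ring

theorem sum_roundMetric_self (x : S2) : ∑ p, roundMetric x p p = 2 := by
  simp only [roundMetric, Finset.sum_sub_distrib, S2.sum_sq]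
  norm_num

theorem sum_roundMetric_mul_grad {f : S2 → ℝ} (hf : IsRadiallySmooth f) (x : S2) (i : Fin 3) :
    ∑ p, roundMetric x i p * grad f x p = grad f x i := by
  rw [sum_roundMetric_mul, sum_coord_mul_grad hf]
  ring

/-- Differentiate `x · grad f = 0`. -/
theorem sum_coord_mul_grad_grad {f : S2 → ℝ} (hf : IsRadiallySmooth f) (x : S2) (j : Fin 3) :
    ∑ p, x.1 p * grad (fun y => grad f y p) x j = -grad f x j := by
  have h : grad (fun y => ∑ p, y.1 p * grad f y p) x j = 0 := by
    simp only [sum_coord_mul_grad hf]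
    exact grad_const 0 x j
  rw [grad_sum fun p => (isRadiallySmooth_coord p).mul (hf.grad p)] at h
  simp only [grad_mul (isRadiallySmooth_coord _) (hf.grad _), grad_coord,
    Finset.sum_add_distrib] at h
  simp only [roundMetric_symm x _ j, sum_roundMetric_mul_grad hf] at h
  linarith

theorem hess_eq {f : S2 → ℝ} (hf : IsRadiallySmooth f) (x : S2) (i j : Fin 3) :
    hess f x i j = grad (fun y => grad f y i) x j + x.1 i * grad f x j := by
  rw [hess, covDeriv₁, sum_roundMetric_mul, sum_coord_mul_grad_grad hf]
  ring

theorem laplacian_eq {f : S2 → ℝ} (hf : IsRadiallySmooth f) (x : S2) :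
    laplacian f x = ∑ i, grad (fun y => grad f y i) x i := by
  simp only [laplacian, hess_eq hf, Finset.sum_add_distrib, sum_coord_mul_grad hf, add_zero]

theorem IsRadiallySmooth.hess {f : S2 → ℝ} (hf : IsRadiallySmooth f) (i j : Fin 3) :
    IsRadiallySmooth fun x => hess f x i j := by
  simp only [hess_eq hf]
  exact ((hf.grad i).grad j).add ((isRadiallySmooth_coord i).mul (hf.grad j))

theorem IsRadiallySmooth.laplacian {f : S2 → ℝ} (hf : IsRadiallySmooth f) :
    IsRadiallySmooth fun x => laplacian f x :=
  .sum fun i => hf.hess i i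

/-! ### The divergence of an electric tensor. -/

theorem tensorOfPotentials_zero_right (c : S2 → ℝ) (x : S2) (i j : Fin 3) :
    tensorOfPotentials c 0 x i j = 2 * hess c x i j - roundMetric x i j * laplacian c x := by
  have h₁ : grad (0 : S2 → ℝ) = fun _ _ => 0 := by
    ext x k
    exact grad_const 0 x k
  have h₂ : ∀ i j, hess (0 : S2 → ℝ) x i j = 0 := by
    intro i j
    simp [hess, covDeriv₁, h₁, grad_const]
  simp [tensorOfPotentials, h₂]

/-- The Laplacian of the tangential derivative of a function, component by component. -/
theorem sum_grad_grad_grad {f : S2 → ℝ} (hf : IsRadiallySmooth f) (x : S2) (p : Fin 3) :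
    ∑ q, grad (fun y => grad (fun z => grad f z p) y q) x q =
      grad (fun y => laplacian f y) x p - 2 * x.1 p * laplacian f x := by
  have hs₁ : ∀ q, IsRadiallySmooth fun y => grad (fun z => grad f z q) y p :=
    fun q => (hf.grad q).grad p
  have hs₂ : ∀ q r, IsRadiallySmooth fun y => y.1 q * grad f y r :=
    fun q r => (isRadiallySmooth_coord q).mul (hf.grad r)
  -- Two commutations, first of the inner pair and then of the outer pair, make the derivative in
  -- direction `p` the last one taken.
  have h₁ : ∀ q, grad (fun y => grad (fun z => grad f z p) y q) x q =
      grad (fun y => grad (fun z => grad f z q) y q) x p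
        + x.1 q * grad (fun y => grad f y q) x p - x.1 p * grad (fun y => grad f y q) x q
        + (roundMetric x q q * grad f x p + x.1 q * grad (fun y => grad f y p) x q)
        - (roundMetric x p q * grad f x q + x.1 p * grad (fun y => grad f y q) x q) := by
    intro q
    have h : (fun y => grad (fun z => grad f z p) y q) = fun y =>
        grad (fun z => grad f z q) y p + y.1 q * grad f y p - y.1 p * grad f y q :=
      funext fun y => grad_grad_comm hf y q p
    rw [h, grad_sub ((hs₁ q).add (hs₂ q p)) (hs₂ p q), grad_add (hs₁ q) (hs₂ q p),
      grad_mul (isRadiallySmooth_coord q) (hf.grad p),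
      grad_mul (isRadiallySmooth_coord p) (hf.grad q), grad_coord, grad_coord,
      grad_grad_comm (hf.grad q) x q p]
  have h₂ : grad (fun y => laplacian f y) x p =
      ∑ q, grad (fun y => grad (fun z => grad f z q) y q) x p := by
    simp only [laplacian_eq hf]
    exact grad_sum (fun q => (hf.grad q).grad q) x p
  simp only [h₁, Finset.sum_add_distrib, Finset.sum_sub_distrib, ← Finset.mul_sum,
    ← Finset.sum_mul, sum_coord_mul_grad_grad hf, sum_coord_mul_grad (hf.grad p),
    sum_roundMetric_mul_grad hf, sum_roundMetric_self, ← laplacian_eq hf, ← h₂]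
  ring

/-- The divergence of an electric tensor field is the gradient of `D² c + 2 c`. -/
theorem sum_grad_electric {c : S2 → ℝ} (hc : IsRadiallySmooth c) (x : S2) (p : Fin 3) :
    ∑ q, grad (fun y => tensorOfPotentials c 0 y p q) x q =
      grad (fun y => laplacian c y + 2 * c y) x p := by
  have hP : ∀ q, grad (fun y => roundMetric y p q) x q =
      -(roundMetric x p q * x.1 q + x.1 p * roundMetric x q q) := by
    intro q
    simp only [roundMetric]
    rw [grad_sub (isRadiallySmooth_const _)
      ((isRadiallySmooth_coord p).mul (isRadiallySmooth_coord q)), grad_const,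
      grad_mul (isRadiallySmooth_coord p) (isRadiallySmooth_coord q), grad_coord, grad_coord]
    simp [roundMetric]
  -- After summation over `q`, the term `roundMetric x p q * grad c x q` yields the curvature
  -- contribution `2 c`, and all multiples of `x_p D² c` cancel.
  have h : ∀ q, grad (fun y => tensorOfPotentials c 0 y p q) x q =
      2 * (grad (fun y => grad (fun z => grad c z p) y q) x q
        + (roundMetric x p q * grad c x q + x.1 p * grad (fun y => grad c y q) x q))
      - (-(x.1 q * roundMetric x q p + x.1 p * roundMetric x q q) * laplacian c x
        + roundMetric x p q * grad (fun y => laplacian c y) x q) := by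
    intro q
    have hs := (isRadiallySmooth_coord p).mul (hc.grad q)
    simp only [tensorOfPotentials_zero_right]
    rw [grad_sub ((hc.hess p q).const_mul 2)
      ((isRadiallySmooth_roundMetric p q).mul hc.laplacian), grad_const_mul 2 (hc.hess p q),
      grad_mul (isRadiallySmooth_roundMetric p q) hc.laplacian, hP]
    simp only [hess_eq hc]
    rw [grad_add ((hc.grad p).grad q) hs, grad_mul (isRadiallySmooth_coord p) (hc.grad q),
      grad_coord, roundMetric_symm x q p]
    ring
  rw [grad_add hc.laplacian (hc.const_mul 2), grad_const_mul 2 hc]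
  simp only [h, Finset.sum_add_distrib, Finset.sum_sub_distrib, ← Finset.mul_sum,
    ← Finset.sum_mul, Finset.sum_neg_distrib, sum_grad_grad_grad hc,
    sum_roundMetric_mul_grad hc, sum_roundMetric_mul_grad hc.laplacian, sum_roundMetric_self,
    sum_coord_mul_roundMetric, ← laplacian_eq hc]
  ring

/-- For a tangential covector `w`, contraction with the divergence needs no projection. -/
theorem sum_mul_divergence {T : S2 → Fin 3 → Fin 3 → ℝ}
    (hT : ∀ i j, IsRadiallySmooth fun x => T x i j) (x : S2) {w : Fin 3 → ℝ}
    (hw : ∑ j, x.1 j * w j = 0) :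
    ∑ j, w j * divergence T x j = ∑ p, w p * ∑ q, grad (fun y => T y p q) x q := by
  -- The projection on the contracted index is absorbed by the tangential `grad`; the one on the
  -- free index only subtracts a normal part, invisible to `w`.
  have h : ∀ j, divergence T x j =
      (∑ q, grad (fun y => T y j q) x q) -
        x.1 j * ∑ p, x.1 p * ∑ q, grad (fun y => T y p q) x q := by
    intro j
    rw [← sum_roundMetric_mul x j fun p => ∑ q, grad (fun y => T y p q) x q]
    simp only [divergence, covDeriv₂]
    rw [Finset.sum_comm]
    refine Finset.sum_congr rfl fun p _ => ?_
    rw [Finset.sum_comm, Finset.mul_sum]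
    refine Finset.sum_congr rfl fun q _ => ?_
    rw [← sum_roundMetric_mul_grad (hT p q) x q, Finset.mul_sum]
    refine Finset.sum_congr rfl fun k _ => ?_
    rw [roundMetric_symm x k q]
    ring
  simp only [h, mul_sub, Finset.sum_sub_distrib]
  rw [sub_eq_self]
  calc
    _ = (∑ j, x.1 j * w j) * ∑ p, x.1 p * ∑ q, grad (fun y => T y p q) x q := by
      rw [Finset.sum_mul]
      exact Finset.sum_congr rfl fun j _ => by ring
    _ = 0 := by rw [hw, zero_mul]

/-! ### Rotation fields and the vanishing integral. -/

/-- The antisymmetric matrix generating the rotation with axis `a`. -/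
def rotationMatrix (a : Fin 3 → ℝ) (i m : Fin 3) : ℝ :=
  Matrix.det (Matrix.of ![Pi.single m 1, Pi.single i 1, a])

theorem rotationMatrix_antisymm (a : Fin 3 → ℝ) (i m : Fin 3) :
    rotationMatrix a i m = -rotationMatrix a m i := by
  fin_cases i <;> fin_cases m <;> simp [rotationMatrix, Matrix.det_fin_three]

/-- The Killing field `ε^{AD} n_{||D}` of the dipole `n = a · x`. -/
theorem sum_volForm_mul_grad_dipole {n : S2 → ℝ} {a : Fin 3 → ℝ}
    (hn : ∀ x : S2, n x = ∑ i, a i * x.1 i) (x : S2) (i : Fin 3) :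
    ∑ l, volForm x i l * grad n x l = ∑ m, rotationMatrix a i m * x.1 m := by
  -- The gradient is the tangential part of `a`; its multiple of `x` drops out of the determinant
  -- `det (x, ·, ·)`.
  have hg : ∀ l, grad n x l = a l - n x * x.1 l := by
    intro l
    rw [hn x, show n = fun y => ∑ i, a i * y.1 i from funext hn,
      grad_sum fun i => (isRadiallySmooth_coord i).const_mul (a i)]
    simp only [grad_const_mul _ (isRadiallySmooth_coord _), grad_coord]
    simp_rw [mul_comm (a _), roundMetric_symm x _ l, sum_roundMetric_mul]
    ring
  simp only [hg, volForm, rotationMatrix, Matrix.det_fin_three]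
  fin_cases i <;> simp [Fin.sum_univ_three] <;> ring

theorem isRadiallySmooth_rotation (a : Fin 3 → ℝ) (i : Fin 3) :
    IsRadiallySmooth fun x => ∑ m, rotationMatrix a i m * x.1 m :=
  .sum fun m => (isRadiallySmooth_coord m).const_mul _

theorem grad_rotation (a : Fin 3 → ℝ) (x : S2) (i j : Fin 3) :
    grad (fun y => ∑ m, rotationMatrix a i m * y.1 m) x j =
      rotationMatrix a i j - x.1 j * ∑ m, rotationMatrix a i m * x.1 m := by
  rw [grad_sum fun m => (isRadiallySmooth_coord m).const_mul _]
  simp only [grad_const_mul _ (isRadiallySmooth_coord _), grad_coord]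
  simp_rw [mul_comm (rotationMatrix a i _), roundMetric_symm x _ j, sum_roundMetric_mul]

/-- This is how the Killing equation enters, with `A` the rotation matrix. -/
theorem sum_antisymm_mul_symm {A T : Fin 3 → Fin 3 → ℝ} (hA : ∀ i j, A i j = -A j i)
    (hT : ∀ i j, T i j = T j i) : ∑ i, ∑ j, A i j * T i j = 0 := by
  have h : ∑ i, ∑ j, A i j * T i j = -∑ i, ∑ j, A i j * T i j := by
    conv_lhs => rw [Finset.sum_comm]
    simp only [← Finset.sum_neg_distrib]
    refine Finset.sum_congr rfl fun i _ => Finset.sum_congr rfl fun j _ => ?_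
    rw [hA, hT]
    ring
  linarith

theorem sum_coord_mul_contraction {x : S2} {T : Fin 3 → Fin 3 → ℝ}
    (hT : ∀ i, ∑ j, x.1 j * T i j = 0) (v : Fin 3 → ℝ) :
    ∑ j, x.1 j * ∑ i, v i * T i j = 0 := by
  simp only [Finset.mul_sum]
  rw [Finset.sum_comm]
  refine Finset.sum_eq_zero fun i _ => ?_
  calc
    _ = v i * ∑ j, x.1 j * T i j := by
      rw [Finset.mul_sum]
      exact Finset.sum_congr rfl fun j _ => by ring
    _ = 0 := by rw [hT, mul_zero]

/-- For a symmetric tangential tensor field whose divergence is a gradient, the contraction with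
a rotation field and that gradient integrates to zero. -/
theorem sphereIntegral_rotation_mul_grad_eq_zero (a : Fin 3 → ℝ) {T : S2 → Fin 3 → Fin 3 → ℝ}
    {F : S2 → ℝ} (hT : ∀ i j, IsRadiallySmooth fun x => T x i j) (hF : IsRadiallySmooth F)
    (hsymm : ∀ x i j, T x i j = T x j i) (htan : ∀ (x : S2) j, ∑ i, x.1 i * T x i j = 0)
    (hdiv : ∀ x p, ∑ q, grad (fun y => T y p q) x q = grad F x p) :
    sphereIntegral (fun x => ∑ j, (∑ i, (∑ m, rotationMatrix a i m * x.1 m) * T x i j) *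
      grad F x j) = 0 := by
  let Y : Fin 3 → S2 → ℝ := fun i x => ∑ m, rotationMatrix a i m * x.1 m
  let W : Fin 3 → S2 → ℝ := fun j x => ∑ i, Y i x * T x i j
  have hY : ∀ i, IsRadiallySmooth (Y i) := isRadiallySmooth_rotation a
  have hYT : ∀ i j, IsRadiallySmooth fun x => Y i x * T x i j := fun i j => (hY i).mul (hT i j)
  have hW : ∀ j, IsRadiallySmooth (W j) := fun j => .sum fun i => hYT i j
  have hYx : ∀ x : S2, ∑ i, x.1 i * Y i x = 0 := by
    intro x
    rw [← sum_antisymm_mul_symm (rotationMatrix_antisymm a)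
      (T := fun i j => x.1 i * x.1 j) fun i j => mul_comm _ _]
    refine Finset.sum_congr rfl fun i _ => ?_
    rw [Finset.mul_sum]
    exact Finset.sum_congr rfl fun j _ => by ring
  have hTx : ∀ (x : S2) i, ∑ j, x.1 j * T x i j = 0 := fun x i => by
    simp only [hsymm x i, htan]
  have hWx : ∀ x : S2, ∑ j, x.1 j * W j x = 0 := fun x =>
    sum_coord_mul_contraction (hTx x) fun i => Y i x
  have hYdiv : ∀ x, ∑ j, grad (Y j) x j = 0 := by
    intro x
    have h : ∀ j, rotationMatrix a j j = 0 := fun j => by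
      linarith [rotationMatrix_antisymm a j j]
    simp only [Y, grad_rotation, h, zero_sub, Finset.sum_neg_distrib]
    exact neg_eq_zero.2 (hYx x)
  -- The derivative of `Y` is the antisymmetric matrix plus a term along `x_j`; `T` annihilates
  -- both, leaving only its divergence.
  have hWdiv : ∀ x, ∑ j, grad (W j) x j = ∑ j, Y j x * grad F x j := by
    intro x
    have h₁ : ∀ j, grad (W j) x j =
        ∑ i, (grad (Y i) x j * T x i j + Y i x * grad (fun y => T y i j) x j) := by
      intro j
      simp only [W]
      rw [grad_sum fun i => hYT i j]
      exact Finset.sum_congr rfl fun i _ => grad_mul (hY i) (hT i j) x j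
    simp only [h₁]
    rw [Finset.sum_comm]
    simp only [Finset.sum_add_distrib, ← Finset.mul_sum, hdiv]
    rw [add_eq_right]
    simp only [Y, grad_rotation, sub_mul, Finset.sum_sub_distrib]
    rw [sum_antisymm_mul_symm (rotationMatrix_antisymm a) (hsymm x), zero_sub, neg_eq_zero]
    refine Finset.sum_eq_zero fun i _ => ?_
    calc
      _ = (∑ m, rotationMatrix a i m * x.1 m) * ∑ j, x.1 j * T x i j := by
        rw [Finset.mul_sum]
        exact Finset.sum_congr rfl fun j _ => by ring
      _ = 0 := by rw [hTx, mul_zero]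
  have hFF := hF.mul hF
  -- The term `F² Y / 2` is chosen so that its divergence `F Y · grad F` cancels `F div W`.
  have hVs : ∀ j, IsRadiallySmooth fun x => F x * W j x - 1 / 2 * (Y j x * (F x * F x)) :=
    fun j => (hF.mul (hW j)).sub (((hY j).mul hFF).const_mul _)
  have hmain := sphereIntegral_div_eq_zero hVs (fun x => by
    have h : ∀ j, x.1 j * (F x * W j x - 1 / 2 * (Y j x * (F x * F x))) =
        F x * (x.1 j * W j x) - 1 / 2 * (F x * F x) * (x.1 j * Y j x) := fun j => by ring
    simp only [h, Finset.sum_sub_distrib, ← Finset.mul_sum, hWx, hYx]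
    ring)
  rw [← hmain]
  congr 1
  ext x
  have h : ∀ j, grad (fun x => F x * W j x - 1 / 2 * (Y j x * (F x * F x))) x j =
      W j x * grad F x j + F x * grad (W j) x j - 1 / 2 * (F x * F x) * grad (Y j) x j
        - F x * (Y j x * grad F x j) := by
    intro j
    rw [grad_sub (hF.mul (hW j)) (((hY j).mul hFF).const_mul _), grad_mul hF (hW j),
      grad_const_mul _ ((hY j).mul hFF), grad_mul (hY j) hFF, grad_mul hF hF]
    ring
  simp only [h, Finset.sum_add_distrib, Finset.sum_sub_distrib, ← Finset.mul_sum, hWdiv, hYdiv]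
  simp only [W, Y]
  ring

end NullInfinity

end

/-! ### Equality of the two angular momenta. -/

theorem mainTheorem10
    (N : NullInfinity.S2 → Fin 3 → ℝ) (hN : NullInfinity.IsOneForm N)
    (χ : NullInfinity.S2 → Fin 3 → Fin 3 → ℝ) (hχ : NullInfinity.IsSymmTracelessTensor χ)
    (n : NullInfinity.S2 → ℝ) (hn : NullInfinity.IsDipole n)
    (b c : NullInfinity.S2 → ℝ) (hb : NullInfinity.IsSmooth b) (hc : NullInfinity.IsSmooth c)
    (hpot : ∀ (x : NullInfinity.S2) (i j : Fin 3),
      χ x i j = NullInfinity.tensorOfPotentials c b x i j)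
    (hb_zero : b = 0) :
    ∀ α : ℝ, NullInfinity.angMomCJK N χ n = NullInfinity.angMomCN α N χ n := by
  intro α
  subst hb_zero
  obtain ⟨a, ha⟩ := hn
  have hcs := hc.isRadiallySmooth
  have hχs : ∀ i j, NullInfinity.IsRadiallySmooth fun x => χ x i j :=
    fun i j => (hχ.smooth i j).isRadiallySmooth
  have hdiv : ∀ x p, ∑ q, NullInfinity.grad (fun y => χ y p q) x q =
      NullInfinity.grad (fun y => NullInfinity.laplacian c y + 2 * c y) x p := by
    intro x p
    simp only [hpot]
    exact NullInfinity.sum_grad_electric hcs x p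
  have hint : NullInfinity.sphereIntegral (fun x => ∑ i, ∑ l, ∑ j,
      NullInfinity.volForm x i l * NullInfinity.grad n x l * χ x i j *
        NullInfinity.divergence χ x j) = 0 := by
    rw [← NullInfinity.sphereIntegral_rotation_mul_grad_eq_zero a hχs
      (hcs.laplacian.add (hcs.const_mul 2)) hχ.symm hχ.tangential hdiv]
    congr 1
    ext x
    simp only [← hdiv, ← NullInfinity.sum_volForm_mul_grad_dipole ha]
    -- Replacing the ambient divergence by the covariant one requires the contraction of `Y` with
    -- `χ` to be tangential, which is the second goal.
    rw [← NullInfinity.sum_mul_divergence hχs]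
    · simp only [Finset.sum_mul]
      conv_rhs => rw [Finset.sum_comm]
      exact Finset.sum_congr rfl fun i _ => Finset.sum_comm
    · exact NullInfinity.sum_coord_mul_contraction
        (fun i => by simp only [hχ.symm x i, hχ.tangential]) _
  rw [NullInfinity.angMomCN, hint]
  ring
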